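/- Call two matrices $A,A'\in\mathbb{R}^{n\times n}$ \emph{neighboring} if $A-A'=\alpha e_se_t^T$ for some standard basis vectors $e_s,e_t$ and some $\alpha\in[-1,1]$. A randomized algorithm $M$ on $\mathbb{R}^{n\times n}$ is \emph{$(\epsilon,\delta)$-differentially private} if $\Pr\{M(A)\in S\}\le e^{\epsilon}\Pr\{M(A')\in S\}+\delta$ for all neighboring $A,A'$ and all measurable sets $S$ of outputs. \emph{Private Power Iteration (PPI)} takes as input a matrix $A\in\mathbb{R}^{n\times n}$, a number of iterations $T\in\mathbb{N}$, privacy parameters $\epsilon,\delta>0$, and a number $C>0$. It puts $\sigma=2\epsilon^{-1}\sqrt{4T\log(1/\delta)}$ and draws $x_0\sim N(0,1/n)^n$ (independent coordinates of variance $1/n$). Then, for $t=1,\dots,T$: if $\|x_{t-1}\|_\infty^2>C/n$, it terminates and outputs ``fail''; otherwise it draws a fresh independent $g_t\sim N(0,C\sigma^2/n)^n$ (independent coordinates of variance $C\sigma^2/n$), puts $x_t'=Ax_{t-1}+g_t$ and $x_t=x_t'/\|x_t'\|_2$. If it has not failed, it outputs $x_T$. \textbf{Lemma.} For all $n,T$,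 all $C>0$, and all $\epsilon,\delta>0$ with $\epsilon\le 16\log(1/\delta)$ (in particular whenever $\epsilon\in(0,1)$ and $\delta\in(0,1/2)$), the algorithm PPI is $(\epsilon,\delta)$-differentially private. -/

import Mathlib

open MeasureTheory ProbabilityTheory
open scoped Matrix ENNReal NNReal

noncomputable section

namespace PPI

/-- Two real matrices are neighboring if their difference is `α e_s e_tᵀ` with `α ∈ [-1, 1]`
(they differ in a single entry, by at most one in absolute value). -/
def Neighboring {m n : ℕ} (A A' : Matrix (Fin m) (Fin n) ℝ) : Prop :=
  ∃ (s : Fin m) (t : Fin n) (α : ℝ), α ∈ Set.Icc (-1 : ℝ) 1 ∧ A - A' = Matrix.single s t α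

/-- `(ε, δ)`-differential privacy of a randomized algorithm on real matrices; `M A` is the law of
the output of the algorithm on input `A`. -/
def IsDifferentiallyPrivate {m n : ℕ} {R : Type*} [MeasurableSpace R]
    (M : Matrix (Fin m) (Fin n) ℝ → Measure R) (ε δ : ℝ) : Prop :=
  ∀ A A' : Matrix (Fin m) (Fin n) ℝ, Neighboring A A' → ∀ S : Set R, MeasurableSet S →
    M A S ≤ ENNReal.ofReal (Real.exp ε) * M A' S + ENNReal.ofReal δ

/-- `N(0, v)^n`: the law of a vector in `ℝ^n` with independent `N(0, v)` coordinates, where `v` is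
the variance. -/
def gaussianVector (n : ℕ) (v : ℝ) : Measure (Fin n → ℝ) :=
  Measure.pi fun _ => gaussianReal 0 v.toNNReal

/-- The noise parameter `σ = 2 ε⁻¹ √(4 T log (1/δ))`. -/
def noiseLevel (T : ℕ) (ε δ : ℝ) : ℝ :=
  2 * ε⁻¹ * Real.sqrt (4 * T * Real.log (1 / δ))

/-- The Euclidean norm of a vector of `Fin n → ℝ`. (The norm `‖x‖` which Mathlib puts on
`Fin n → ℝ` is the maximum norm.) -/
def norm₂ {n : ℕ} (x : Fin n → ℝ) : ℝ := Real.sqrt (∑ i, x i ^ 2)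

/-- The state of the algorithm between two rounds, and its output: a vector, or `fail`. -/
abbrev Outcome (n : ℕ) : Type := (Fin n → ℝ) ⊕ Unit

/-- The outcome `fail`. -/
def fail {n : ℕ} : Outcome n := Sum.inr ()

/-- A power iteration step with noise `g`: `x' = A x + g`, followed by `x = x' / ‖x'‖₂`. -/
def powerStep {n : ℕ} (A : Matrix (Fin n) (Fin n) ℝ) (x g : Fin n → ℝ) : Fin n → ℝ :=
  (norm₂ (A *ᵥ x + g))⁻¹ • (A *ᵥ x + g)

open Classical in
/-- One round of the algorithm, as the law of the new state given the old one: if the run has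
already failed it stays failed; if `‖x‖_∞² > C/n` it fails; otherwise a fresh
`g ∼ N(0, C σ² / n)^n` is drawn and a power iteration step with noise `g` is made. -/
def iterationRound {n : ℕ} (A : Matrix (Fin n) (Fin n) ℝ) (σ C : ℝ) :
    Outcome n → Measure (Outcome n)
  | Sum.inl x =>
      if C / n < ‖x‖ ^ 2 then Measure.dirac fail
      else (gaussianVector n (C * σ ^ 2 / n)).map fun g => Sum.inl (powerStep A x g)
  | Sum.inr _ => Measure.dirac fail

/-- The law of the state after `t` rounds, started from `x₀ ∼ N(0, 1/n)^n`. -/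
def stateLaw {n : ℕ} (A : Matrix (Fin n) (Fin n) ℝ) (σ C : ℝ) : ℕ → Measure (Outcome n)
  | 0 => (gaussianVector n (1 / n)).map Sum.inl
  | t + 1 => (stateLaw A σ C t).bind (iterationRound A σ C)

/-- Private power iteration: the law of the output on input `A`, with `T` rounds, privacy
parameters `ε, δ` and coherence bound `C`. -/
def privatePowerIteration {n : ℕ} (T : ℕ) (ε δ C : ℝ) (A : Matrix (Fin n) (Fin n) ℝ) :
    Measure (Outcome n) :=
  stateLaw A (noiseLevel T ε δ) C T

instance (n : ℕ) (v : ℝ) : IsProbabilityMeasure (gaussianVector n v) := by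
  unfold gaussianVector; infer_instance

theorem measurable_powerStep {n : ℕ} (A : Matrix (Fin n) (Fin n) ℝ) :
    Measurable fun p : (Fin n → ℝ) × (Fin n → ℝ) => powerStep A p.1 p.2 := by
  have h : Measurable fun p : (Fin n → ℝ) × (Fin n → ℝ) => A *ᵥ p.1 + p.2 := by
    refine measurable_pi_lambda _ fun i => ?_
    simp only [Pi.add_apply, Matrix.mulVec, dotProduct]
    fun_prop
  have h2 : Measurable fun p : (Fin n → ℝ) × (Fin n → ℝ) => norm₂ (A *ᵥ p.1 + p.2) := by
    unfold norm₂
    refine Measurable.sqrt (Finset.measurable_sum _ fun i _ => ?_)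
    exact ((measurable_pi_apply i).comp h).pow_const 2
  exact h2.inv.smul h

theorem measurable_powerStep_inl {n : ℕ} (A : Matrix (Fin n) (Fin n) ℝ) (x : Fin n → ℝ) :
    Measurable fun g => (Sum.inl (powerStep A x g) : Outcome n) := by
  have h : Measurable fun g : Fin n → ℝ => (x, g) := measurable_const.prodMk measurable_id
  have h' := (measurable_powerStep A).comp h
  exact measurable_inl.comp h'

/-- A round is a Markov kernel, so that `Measure.bind` in `stateLaw` has its intended meaning. -/
theorem measurable_iterationRound {n : ℕ} (A : Matrix (Fin n) (Fin n) ℝ) (σ C : ℝ) :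
    Measurable (iterationRound A σ C) := by
  classical
  refine measurable_fun_sum ?_ measurable_const
  refine Measurable.ite (p := fun x : Fin n → ℝ => C / n < ‖x‖ ^ 2) ?_ measurable_const ?_
  · exact measurableSet_lt measurable_const (measurable_norm.pow_const 2)
  · refine Measure.measurable_of_measurable_coe _ fun s hs => ?_
    simp_rw [Measure.map_apply (measurable_powerStep_inl A _) hs]
    exact measurable_measure_prodMk_left
      (measurable_powerStep A (measurable_inl (β := Unit) hs))

instance {n : ℕ} (A : Matrix (Fin n) (Fin n) ℝ) (σ C : ℝ) (x : Outcome n) :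
    IsProbabilityMeasure (iterationRound A σ C x) := by
  rcases x with x | x
  · simp only [iterationRound]
    split_ifs
    · infer_instance
    · exact Measure.isProbabilityMeasure_map (measurable_powerStep_inl A x).aemeasurable
  · simp only [iterationRound]; infer_instance

instance {n : ℕ} (T : ℕ) (ε δ C : ℝ) (A : Matrix (Fin n) (Fin n) ℝ) :
    IsProbabilityMeasure (privatePowerIteration T ε δ C A) := by
  unfold privatePowerIteration
  generalize noiseLevel T ε δ = σ
  induction T with
  | zero => exact Measure.isProbabilityMeasure_map measurable_inl.aemeasurable
  | succ t ih =>
    refine ⟨?_⟩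
    rw [stateLaw, Measure.bind_apply MeasurableSet.univ
      (measurable_iterationRound A σ C).aemeasurable]
    simp only [measure_univ, lintegral_const, mul_one]

end PPI

end

/-! Privacy loss is measured by a Rényi divergence of order `a`, in the Hölder-dual form
`RenyiBound`, where `p` is conjugate to `a`. This form survives post-processing (`map`), and its
constants multiply under adaptive composition (`bind`). Given the state, neighboring matrices change
`A x` in one coordinate only, by at most `√(C/n)` once the test is passed, so a round costs a
Gaussian shift: `a / (2σ²)` in the exponent. After `T` rounds, `measure_le` turns the total into
`(ε, δ)`-privacy for a suitable `p`. -/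

/-- `P` is controlled by `Q` in the sense of a bounded Rényi divergence of the order conjugate to
`p`, written in dual form. -/
def RenyiBound {α : Type*} [MeasurableSpace α] (p : ℝ) (K : ℝ≥0∞) (P Q : Measure α) : Prop :=
  ∀ f : α → ℝ≥0∞, Measurable f → (∫⁻ x, f x ∂P) ^ p ≤ K * ∫⁻ x, f x ^ p ∂Q

/-! ### Calculus of Rényi bounds -/

namespace RenyiBound

variable {α β : Type*} [MeasurableSpace α] [MeasurableSpace β] {p : ℝ} {K L : ℝ≥0∞}
  {P Q : Measure α}

theorem mono (h : RenyiBound p K P Q) (hKL : K ≤ L) : RenyiBound p L P Q := fun f hf =>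
  (h f hf).trans (by gcongr)

theorem map {F : α → β} (hF : Measurable F) (h : RenyiBound p K P Q) :
    RenyiBound p K (P.map F) (Q.map F) := by
  intro f hf
  rw [lintegral_map hf hF, lintegral_map (hf.pow_const p) hF]
  exact h _ (hf.comp hF)

/-- Adaptive composition: the bound for `P`, `Q` is tested on the inner integral, whose `p`-th power
is just what the bound on the kernels controls. -/
theorem bind {κ η : α → Measure β} (hκ : Measurable κ) (hη : Measurable η)
    (h : RenyiBound p K P Q) (hκη : ∀ x, RenyiBound p L (κ x) (η x)) :
    RenyiBound p (K * L) (P.bind κ) (Q.bind η) := by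
  intro f hf
  rw [Measure.lintegral_bind hκ.aemeasurable hf.aemeasurable,
    Measure.lintegral_bind hη.aemeasurable (hf.pow_const p).aemeasurable]
  calc (∫⁻ x, ∫⁻ y, f y ∂κ x ∂P) ^ p
      ≤ K * ∫⁻ x, (∫⁻ y, f y ∂κ x) ^ p ∂Q :=
        h _ ((Measure.measurable_lintegral hf).comp hκ)
    _ ≤ K * ∫⁻ x, L * ∫⁻ y, f y ^ p ∂η x ∂Q := by
        gcongr with x
        exact hκη x f hf
    _ = K * L * ∫⁻ x, ∫⁻ y, f y ^ p ∂η x ∂Q := by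
        have hm : Measurable fun x => ∫⁻ y, f y ^ p ∂η x :=
          (Measure.measurable_lintegral (hf.pow_const p)).comp hη
        rw [lintegral_const_mul _ hm, mul_assoc]

/-- Hölder's inequality for a density `r` of `P` with respect to `Q`. -/
theorem of_density {a : ℝ} (hpa : p.HolderConjugate a) {r : α → ℝ≥0∞} (hr : Measurable r)
    (hP : P = Q.withDensity r) :
    RenyiBound p ((∫⁻ x, r x ^ a ∂Q) ^ (p / a)) P Q := by
  intro f hf
  have hp := hpa.pos
  rw [hP, lintegral_withDensity_eq_lintegral_mul _ hr hf]
  calc (∫⁻ x, (r * f) x ∂Q) ^ p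
      ≤ ((∫⁻ x, r x ^ a ∂Q) ^ (1 / a) * (∫⁻ x, f x ^ p ∂Q) ^ (1 / p)) ^ p := by
        gcongr
        exact ENNReal.lintegral_mul_le_Lp_mul_Lq Q hpa.symm hr.aemeasurable hf.aemeasurable
    _ = _ := by
        rw [ENNReal.mul_rpow_of_nonneg _ _ hp.le, ← ENNReal.rpow_mul, ← ENNReal.rpow_mul,
          one_div_mul_cancel hp.ne', ENNReal.rpow_one, one_div_mul_eq_div]

/-- Jensen's inequality. -/
theorem refl {a : ℝ} (hpa : p.HolderConjugate a) [IsProbabilityMeasure P] :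
    RenyiBound p 1 P P := by
  have h := of_density hpa (P := P) (Q := P) measurable_one withDensity_one.symm
  simpa using h

theorem prod_right {a : ℝ} (hpa : p.HolderConjugate a) [SFinite P] [SFinite Q]
    (h : RenyiBound p K P Q) (ρ : Measure β) [IsProbabilityMeasure ρ] :
    RenyiBound p K (P.prod ρ) (Q.prod ρ) := by
  intro f hf
  rw [lintegral_prod_symm _ hf.aemeasurable, lintegral_prod_symm _ (hf.pow_const p).aemeasurable]
  calc (∫⁻ y, ∫⁻ x, f (x, y) ∂P ∂ρ) ^ p
      ≤ 1 * ∫⁻ y, (∫⁻ x, f (x, y) ∂P) ^ p ∂ρ := refl hpa _ hf.lintegral_prod_left'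
    _ ≤ 1 * ∫⁻ y, K * ∫⁻ x, f (x, y) ^ p ∂Q ∂ρ := by
        gcongr with y
        exact h _ (hf.comp measurable_prodMk_right)
    _ = _ := by
        rw [lintegral_const_mul _ (hf.pow_const p).lintegral_prod_left', one_mul]

/-- The conversion of a Rényi bound into approximate differential privacy. -/
theorem measure_le {δ ε D : ℝ} (hp : 1 ≤ p) (hδ : 0 < δ)
    (h : RenyiBound p (ENNReal.ofReal (Real.exp D)) P Q) [IsFiniteMeasure P]
    (hε : D + (p - 1) * Real.log (1 / δ) ≤ ε) {S : Set α} (hS : MeasurableSet S) :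
    P S ≤ ENNReal.ofReal (Real.exp ε) * Q S + ENNReal.ofReal δ := by
  rcases le_total (P S) (ENNReal.ofReal δ) with hle | hle
  · exact hle.trans le_add_self
  refine le_add_right ?_
  have hp0 : 0 < p := by linarith
  have hPS : P S ^ p ≤ ENNReal.ofReal (Real.exp D) * Q S := by
    have h' := h (S.indicator 1) (measurable_one.indicator hS)
    have h1 : (fun x => S.indicator (1 : α → ℝ≥0∞) x ^ p) = S.indicator 1 := by
      ext x
      by_cases hx : x ∈ S <;> simp [hx, hp0]
    rw [h1, lintegral_indicator_one hS, lintegral_indicator_one hS] at h'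
    exact h'
  have hpos : P S ≠ 0 := (lt_of_lt_of_le (ENNReal.ofReal_pos.2 hδ) hle).ne'
  -- As `1 - p ≤ 0` and `P S ≥ δ`, the first factor is at most `δ ^ (1 - p)`.
  calc P S = P S ^ (1 - p) * P S ^ p := by
        rw [← ENNReal.rpow_add _ _ hpos (measure_ne_top P S), sub_add_cancel, ENNReal.rpow_one]
    _ ≤ ENNReal.ofReal δ ^ (1 - p) * (ENNReal.ofReal (Real.exp D) * Q S) := by
        refine mul_le_mul' ?_ hPS
        rw [← neg_sub p 1, ENNReal.rpow_neg, ENNReal.rpow_neg]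
        exact ENNReal.inv_le_inv.2 (ENNReal.rpow_le_rpow hle (by linarith))
    _ = ENNReal.ofReal (Real.exp (D + (p - 1) * Real.log (1 / δ))) * Q S := by
        rw [ENNReal.ofReal_rpow_of_pos hδ, ← mul_assoc, ← ENNReal.ofReal_mul (by positivity),
          Real.rpow_def_of_pos hδ, ← Real.exp_add, one_div, Real.log_inv]
        ring_nf
    _ ≤ _ := by gcongr

end RenyiBound

/-! ### Gaussian shifts -/

/-- Rényi divergence of two Gaussians with the same variance. -/
theorem renyiBound_gaussianReal {p a : ℝ} (hpa : p.HolderConjugate a) (d : ℝ) {v : ℝ≥0}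
    (hv : v ≠ 0) :
    RenyiBound p (ENNReal.ofReal (Real.exp (a * d ^ 2 / (2 * v))))
      (gaussianReal d v) (gaussianReal 0 v) := by
  have hv' : (v : ℝ) ≠ 0 := by exact_mod_cast hv
  let r : ℝ → ℝ≥0∞ := fun x => ENNReal.ofReal (Real.exp ((2 * d * x - d ^ 2) / (2 * v)))
  have hr : Measurable r := by fun_prop
  have hP : gaussianReal d v = (gaussianReal 0 v).withDensity r := by
    rw [gaussianReal_of_var_ne_zero _ hv, gaussianReal_of_var_ne_zero _ hv,
      ← withDensity_mul _ (measurable_gaussianPDF _ _) hr]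
    congr 1
    ext x
    simp only [Pi.mul_apply, gaussianPDF, r]
    rw [← ENNReal.ofReal_mul (gaussianPDFReal_nonneg _ _ _)]
    simp only [gaussianPDFReal]
    rw [mul_assoc _ (Real.exp _), ← Real.exp_add]
    congr 3
    field_simp
    ring
  have hI : ∫⁻ x, r x ^ a ∂gaussianReal 0 v
      = ENNReal.ofReal (Real.exp (a * (a - 1) * d ^ 2 / (2 * v))) := by
    rw [gaussianReal_of_var_ne_zero _ hv,
      lintegral_withDensity_eq_lintegral_mul _ (measurable_gaussianPDF _ _) (hr.pow_const a)]
    -- Completing the square: tilting by `r ^ a` moves the mean to `a * d`.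
    have h : ∀ x, (gaussianPDF 0 v * fun x => r x ^ a) x
        = ENNReal.ofReal (Real.exp (a * (a - 1) * d ^ 2 / (2 * v))) * gaussianPDF (a * d) v x := by
      intro x
      simp only [Pi.mul_apply, gaussianPDF, r]
      rw [ENNReal.ofReal_rpow_of_pos (Real.exp_pos _), ← Real.exp_mul,
        ← ENNReal.ofReal_mul (gaussianPDFReal_nonneg _ _ _),
        ← ENNReal.ofReal_mul (Real.exp_pos _).le]
      simp only [gaussianPDFReal]
      rw [mul_assoc _ (Real.exp _), ← Real.exp_add, mul_left_comm, ← Real.exp_add]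
      congr 3
      field_simp
      ring
    simp_rw [h]
    rw [lintegral_const_mul _ (measurable_gaussianPDF _ _), lintegral_gaussianPDF_eq_one _ hv,
      mul_one]
  refine (RenyiBound.of_density hpa hr hP).mono (le_of_eq ?_)
  rw [hI, ENNReal.ofReal_rpow_of_pos (Real.exp_pos _), ← Real.exp_mul]
  have ha : a - 1 ≠ 0 := hpa.symm.sub_one_ne_zero
  have ha0 : a ≠ 0 := hpa.symm.ne_zero
  have hp : p / a = 1 / (a - 1) := by
    rw [hpa.symm.conjugate_eq]
    field_simp
  rw [hp]
  congr 2
  field_simp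

/-- The shift touches only coordinate `s`; the other coordinates split off as a common product
factor. -/
theorem renyiBound_gaussianVector {p a : ℝ} (hpa : p.HolderConjugate a) {n : ℕ} (s : Fin n)
    (d : ℝ) {v : ℝ} (hv : 0 < v) :
    RenyiBound p (ENNReal.ofReal (Real.exp (a * d ^ 2 / (2 * v))))
      ((PPI.gaussianVector n v).map fun g => Pi.single s d + g) (PPI.gaussianVector n v) := by
  obtain ⟨n, rfl⟩ : ∃ m, n = m + 1 := ⟨n - 1, by have := s.pos; omega⟩
  let γ := gaussianReal 0 v.toNNReal
  let R : Measure (Fin n → ℝ) := Measure.pi fun _ => γ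
  have hmp : MeasurePreserving (MeasurableEquiv.piFinSuccAbove (fun _ => ℝ) s).symm
      (γ.prod R) (PPI.gaussianVector (n + 1) v) :=
    (measurePreserving_piFinSuccAbove (fun _ : Fin (n + 1) => γ) s).symm _
  have hshift : Measurable fun g : Fin (n + 1) → ℝ => Pi.single s d + g := by fun_prop
  have hmap : (PPI.gaussianVector (n + 1) v).map (fun g => Pi.single s d + g)
      = ((gaussianReal d v.toNNReal).prod R).map
        (MeasurableEquiv.piFinSuccAbove (fun _ => ℝ) s).symm := by
    have hγ : gaussianReal d v.toNNReal = γ.map fun x => d + x := by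
      rw [gaussianReal_map_const_add, zero_add]
    have hadd : Measurable fun x : ℝ => d + x := by fun_prop
    rw [← hmp.map_eq, hγ, Measure.map_map hshift hmp.measurable]
    conv_rhs => rw [← Measure.map_id (μ := R)]
    rw [Measure.map_prod_map _ _ hadd measurable_id, Measure.map_map hmp.measurable
      (hadd.prodMap measurable_id)]
    congr 1
    ext x i
    refine Fin.succAboveCases s ?_ (fun j => ?_) i
    · simp [MeasurableEquiv.piFinSuccAbove, Fin.insertNthEquiv]
    · simp [MeasurableEquiv.piFinSuccAbove, Fin.insertNthEquiv]
  rw [hmap, ← hmp.map_eq]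
  have hv' : v.toNNReal ≠ 0 := by simpa using hv
  have h := renyiBound_gaussianReal hpa d hv'
  rw [Real.coe_toNNReal v hv.le] at h
  exact (h.prod_right hpa R).map hmp.measurable

/-! ### The rounds of the algorithm -/

namespace PPI

/-- The change of matrix is absorbed into the noise. -/
theorem powerStep_of_neighboring {n : ℕ} {A A' : Matrix (Fin n) (Fin n) ℝ} {s t : Fin n} {α : ℝ}
    (h : A - A' = Matrix.single s t α) (x g : Fin n → ℝ) :
    powerStep A x g = powerStep A' x (Pi.single s (α * x t) + g) := by
  have hx : A *ᵥ x = A' *ᵥ x + Pi.single s (α * x t) := by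
    rw [← sub_eq_iff_eq_add', ← Matrix.sub_mulVec, h, Matrix.single_mulVec]
    rfl
  rw [powerStep, powerStep, hx, add_assoc]

/-- The failure test depends on `x` alone, so both inputs take the same branch. -/
theorem renyiBound_iterationRound {p a : ℝ} (hpa : p.HolderConjugate a) {n : ℕ}
    {A A' : Matrix (Fin n) (Fin n) ℝ} (h : Neighboring A A') {σ C : ℝ} (hσ : 0 < σ) (hC : 0 < C)
    (x : Outcome n) :
    RenyiBound p (ENNReal.ofReal (Real.exp (a / (2 * σ ^ 2))))
      (iterationRound A σ C x) (iterationRound A' σ C x) := by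
  have ha := hpa.symm.pos
  have hone : (1 : ℝ≥0∞) ≤ ENNReal.ofReal (Real.exp (a / (2 * σ ^ 2))) := by
    rw [ENNReal.one_le_ofReal, Real.one_le_exp_iff]
    positivity
  rcases x with x | x
  swap
  · exact (RenyiBound.refl hpa).mono hone
  simp only [iterationRound]
  split_ifs with hx
  · exact (RenyiBound.refl hpa).mono hone
  obtain ⟨s, t, α, hα, hA⟩ := h
  have hn : (0 : ℝ) < n := by exact_mod_cast s.pos
  have hstep : (fun g => (Sum.inl (powerStep A x g) : Outcome n))
      = (fun g => Sum.inl (powerStep A' x g)) ∘ fun g => Pi.single s (α * x t) + g := by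
    ext1 g
    simp [powerStep_of_neighboring hA]
  rw [hstep, ← Measure.map_map (measurable_powerStep_inl A' x) (by fun_prop)]
  refine ((renyiBound_gaussianVector hpa s (α * x t) (by positivity)).map
    (measurable_powerStep_inl A' x)).mono (ENNReal.ofReal_le_ofReal (Real.exp_le_exp.2 ?_))
  have hd : (α * x t) ^ 2 ≤ C / n := by
    calc (α * x t) ^ 2 = α ^ 2 * x t ^ 2 := by ring
      _ ≤ 1 * ‖x‖ ^ 2 := by
          have h1 : α ^ 2 ≤ 1 := by nlinarith [hα.1, hα.2]
          have h2 : x t ^ 2 ≤ ‖x‖ ^ 2 := by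
            rw [← sq_abs]
            exact pow_le_pow_left₀ (abs_nonneg _) (norm_le_pi_norm x t) 2
          exact mul_le_mul h1 h2 (sq_nonneg _) zero_le_one
      _ ≤ C / n := by rw [one_mul]; exact not_lt.1 hx
  calc a * (α * x t) ^ 2 / (2 * (C * σ ^ 2 / n)) ≤ a * (C / n) / (2 * (C * σ ^ 2 / n)) := by
        gcongr
    _ = a / (2 * σ ^ 2) := by field_simp

theorem renyiBound_stateLaw {p a : ℝ} (hpa : p.HolderConjugate a) {n : ℕ}
    {A A' : Matrix (Fin n) (Fin n) ℝ} (h : Neighboring A A') {σ C : ℝ} (hσ : 0 < σ) (hC : 0 < C)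
    (T : ℕ) :
    RenyiBound p (ENNReal.ofReal (Real.exp (T * (a / (2 * σ ^ 2)))))
      (stateLaw A σ C T) (stateLaw A' σ C T) := by
  induction T with
  | zero =>
    have : IsProbabilityMeasure (stateLaw A σ C 0) :=
      Measure.isProbabilityMeasure_map measurable_inl.aemeasurable
    rw [Nat.cast_zero, zero_mul, Real.exp_zero, ENNReal.ofReal_one]
    exact RenyiBound.refl hpa
  | succ T ih =>
    have := ih.bind (measurable_iterationRound A σ C) (measurable_iterationRound A' σ C)
      (renyiBound_iterationRound hpa h hσ hC)
    rw [← ENNReal.ofReal_mul (Real.exp_pos _).le, ← Real.exp_add] at this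
    rw [Nat.cast_succ, add_one_mul]
    exact this

end PPI

theorem mainTheorem6 (n T : ℕ) (ε δ C : ℝ) (hε : 0 < ε) (hδ : 0 < δ) (hC : 0 < C)
    (hεδ : ε ≤ 16 * Real.log (1 / δ)) :
    PPI.IsDifferentiallyPrivate
      (fun A : Matrix (Fin n) (Fin n) ℝ => PPI.privatePowerIteration T ε δ C A) ε δ := by
  intro A A' h S hS
  rcases Nat.eq_zero_or_pos T with rfl | hT
  -- With no rounds the output ignores the matrix; this case is separate because the noise level is
  -- zero.
  · refine le_add_right ?_
    simp only [PPI.privatePowerIteration, PPI.stateLaw]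
    refine le_mul_of_one_le_left' ?_
    rw [ENNReal.one_le_ofReal, Real.one_le_exp_iff]
    exact hε.le
  have hl : 0 < Real.log (1 / δ) := by linarith
  set l := Real.log (1 / δ) with hl_def
  have hT' : (0 : ℝ) < T := by exact_mod_cast hT
  -- With `p - 1 = ε / (4 * l)` the conversion costs `ε / 4` and the rounds cost `ε / 8 + ε² / (32 *
  -- l)`; the last term is at most `ε / 2` since `ε ≤ 16 * l`.
  have hpa : (1 + ε / (4 * l)).HolderConjugate (1 + 4 * l / ε) := by
    rw [Real.holderConjugate_iff]
    refine ⟨by linarith [show 0 < ε / (4 * l) by positivity], ?_⟩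
    have : 4 * l + ε ≠ 0 := by positivity
    field_simp
    ring
  have hσ : 0 < PPI.noiseLevel T ε δ := by
    unfold PPI.noiseLevel
    positivity
  have hσ2 : PPI.noiseLevel T ε δ ^ 2 = 16 * T * l / ε ^ 2 := by
    unfold PPI.noiseLevel
    rw [mul_pow, Real.sq_sqrt (by positivity)]
    field_simp
    ring
  have hfin : IsFiniteMeasure (PPI.stateLaw A (PPI.noiseLevel T ε δ) C T) :=
    inferInstanceAs (IsFiniteMeasure (PPI.privatePowerIteration T ε δ C A))
  refine (PPI.renyiBound_stateLaw hpa h hσ hC T).measure_le hpa.lt.le hδ ?_ hS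
  rw [hσ2, ← hl_def]
  have heq : T * ((1 + 4 * l / ε) / (2 * (16 * T * l / ε ^ 2)))
      + (1 + ε / (4 * l) - 1) * l = ε / l * ε / 32 + 3 / 8 * ε := by
    field_simp
    ring
  rw [heq]
  have : ε / l ≤ 16 := by rwa [div_le_iff₀ hl]
  nlinarith
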